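/- **Setting.** Let $\Gamma\subset\mathbb R^2$ be a lattice with unit cell $\Omega$, and let $g_1,g_2$ be generators of its reciprocal lattice $\Gamma^*$ ($R\cdot G\in 2\pi\mathbb Z$ for $R\in\Gamma$, $G\in\Gamma^*$). Let $H$ be a $\Gamma$-periodic symmetric single-particle Hamiltonian acting on $\mathbb C^\kappa$-valued functions on $\mathbb R^2$ ($\kappa$ a finite set of internal indices), with flat bands indexed by a finite set $\mathcal N$ with $\#\mathcal N=2M$. Let $\psi_{n\mathbf k}=e^{i\mathbf k\cdot\mathbf r}u_{n\mathbf k}$ be Bloch eigenfunctions of these bands: $H\psi_{n\mathbf k}=E_n\psi_{n\mathbf k}$, $u_{n\mathbf k}$ is $\Gamma$-periodic and square integrable on $\Omega$, $\psi_{n(\mathbf k+\mathbf G)}=\psi_{n\mathbf k}$ for $\mathbf G\in\Gamma^*$, and $\int_\Omega\langle \psi_{m\mathbf k},\psi_{n\mathbf k}\rangle\,d\mathbf r=\delta_{mn}$. Let $\mathcal K=\{\tfrac{i}{n_1}g_1+\tfrac{j}{n_2}g_2: 0\le i<n_1,\ 0\le j<n_2\}$ with $n_1,n_2\ge1$, and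 $N_{\mathbf k}=n_1n_2$. With $\hat u_{n\mathbf k}(\mathbf G;s)=\int_\Omega e^{-i\mathbf G\cdot\mathbf r}u_{n\mathbf k}(\mathbf r;s)\,d\mathbf r$, the form factors are the matrices $$[\Lambda_{\mathbf k}(\mathbf q)]_{mn}=\frac1{|\Omega|}\sum_{\mathbf G'\in\Gamma^*}\sum_{s\in\kappa}\overline{\hat u_{m\mathbf k}(\mathbf G';s)}\,\hat u_{n(\mathbf k+\mathbf q)}(\mathbf G';s),\qquad \mathbf k\in\mathcal K,\ \mathbf q\in\mathcal K+\Gamma^*.$$ Let $\hat f^\dagger_{n\mathbf k},\hat f_{n\mathbf k}$ ($n\in\mathcal N$, $\mathbf k\in\mathcal K$) be the fermionic creation and annihilation operators on the Fock space over the modes $\mathcal N\times\mathcal K$, extended $\Gamma^*$-periodically in $\mathbf k$. For a radial function $\hat V>0$ on $\mathbb R^2$ (the Fourier transform of the interaction), the flat band interacting (FBI) Hamiltonian is $$\hat H=\frac1{N_{\mathbf k}|\Omega|}\sum_{\mathbf q\in\mathcal K+\Gamma^*}\hat V(\mathbf q)\,\hat\rho(\mathbf q)\hat\rho(-\mathbf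 q),\qquad \hat\rho(\mathbf q)=\sum_{\mathbf k\in\mathcal K}\sum_{m,n\in\mathcal N}[\Lambda_{\mathbf k}(\mathbf q)]_{mn}\Big(\hat f^\dagger_{m\mathbf k}\hat f_{n(\mathbf k+\mathbf q)}-\tfrac12\delta_{mn}\delta_{\mathbf q\in\Gamma^*}\Big),$$ where the series is assumed to converge (unconditionally). It is *frustration-free* if it has a ground state $\Phi$ with $\langle\Phi,\hat V(\mathbf q)\hat\rho(\mathbf q)\hat\rho(-\mathbf q)\Phi\rangle=0$ for every $\mathbf q\in\mathcal K+\Gamma^*$. A *Hartree-Fock ground state* is a Slater determinant $\Psi$ of $MN_{\mathbf k}$ orthonormal orbitals (half filling) that is a ground state of $\hat H$, i.e. minimizes $\langle\Phi,\hat H\Phi\rangle$ over all unit vectors $\Phi$ of the Fock space. Its 1-RDM is the family of matrices $[P(\mathbf k,\mathbf k')]_{nm}=\langle\Psi,\hat f^\dagger_{m\mathbf k'}\hat f_{n\mathbf k}\Psi\rangle$. **Proposition (no translation symmetry breaking).** Let $P$ be the 1-RDM of a Hartree-Fock ground state of a frustration-free FBI Hamiltonian. For any $\mathbf k,\mathbf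 k'\in\mathcal K$, if there exists $\mathbf G\in\Gamma^*$ such that $\Lambda_{\mathbf k}(\mathbf G)$ and $\Lambda_{\mathbf k'}(\mathbf G)$ have no common eigenvalue, then $P(\mathbf k,\mathbf k')=0$. -/

import Mathlib

open scoped BigOperators ComplexConjugate
open MeasureTheory

noncomputable section

namespace FBI

/-! ## Fermionic Fock space over a finite set of modes -/

section Fock

variable {ι : Type*} [Fintype ι] [DecidableEq ι]

variable (ι) in
/-- The fermionic Fock space over a finite set `ι` of modes, in the occupation number
representation: the basis vector of `S : Finset ι` is the state in which exactly the modes of `S`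
are occupied. -/
abbrev Fock : Type _ := EuclideanSpace ℂ (Finset ι)

variable (ι) in
/-- Linear operators on the (finite dimensional) Fock space. -/
abbrev FockOp : Type _ := Fock ι →L[ℂ] Fock ι

/-- The Jordan-Wigner sign `(-1) ^ #{j ∈ S | j precedes i}` (for a fixed enumeration of modes). -/
def jwSign (i : ι) (S : Finset ι) : ℂ :=
  (-1) ^ (S.filter fun j => Fintype.equivFin ι j < Fintype.equivFin ι i).card

/-- The creation operator `f†_i`: it sends the basis state of `S` to `±` the basis state of
`S ∪ {i}` if `i ∉ S`, and to `0` if `i ∈ S`. -/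
def create (i : ι) : FockOp ι :=
  Matrix.toEuclideanCLM (n := Finset ι) (𝕜 := ℂ)
    (Matrix.of fun T S => if i ∉ S ∧ T = insert i S then jwSign i S else 0)

/-- The annihilation operator `f_i`, the adjoint of `f†_i`. -/
def annihilate (i : ι) : FockOp ι := ContinuousLinearMap.adjoint (create i)

variable (ι) in
/-- The vacuum state. -/
def vacuum : Fock ι := EuclideanSpace.single (∅ : Finset ι) (1 : ℂ)

/-- The creation operator `b† = ∑ᵢ Ξ(i) f†_i` of the orbital `Ξ`. -/
def createOrbital (Ξ : ι → ℂ) : FockOp ι := ∑ i, Ξ i • create i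

/-- The Slater determinant `b†_1 b†_2 ⋯ b†_r |vac⟩` of the orbitals `Ξ_1, …, Ξ_r`. -/
def slater {r : ℕ} (Ξ : Fin r → ι → ℂ) : Fock ι :=
  (List.ofFn fun a => createOrbital (Ξ a)).prod (vacuum ι)

/-- `Ψ` is a Slater determinant of `r` orthonormal orbitals. -/
def IsSlaterDeterminant (r : ℕ) (Ψ : Fock ι) : Prop :=
  ∃ Ξ : Fin r → ι → ℂ,
    (∀ a b, ∑ i, conj (Ξ a i) * Ξ b i = if a = b then 1 else 0) ∧ Ψ = slater Ξ

/-- `Ψ` is a (normalized) ground state of the operator `A`: it minimizes the energy `⟨Φ, A Φ⟩`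
among all normalized vectors of the Fock space. -/
def IsGroundState (A : FockOp ι) (Ψ : Fock ι) : Prop :=
  ‖Ψ‖ = 1 ∧ ∀ Φ : Fock ι, ‖Φ‖ = 1 → (inner ℂ Ψ (A Ψ)).re ≤ (inner ℂ Φ (A Φ)).re

end Fock

/-! ## Lattices, momenta and Bloch functions -/

/-- The plane `ℝ²`. -/
abbrev Plane : Type := EuclideanSpace ℝ (Fin 2)

/-- A lattice in the plane with generators `a 0, a 1`, and the dual generators `g 0, g 1` of its
reciprocal lattice, normalized by `a i · g j = 2π δ_ij`. -/
structure Lattice where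
  a : Module.Basis (Fin 2) ℝ Plane
  g : Module.Basis (Fin 2) ℝ Plane
  inner_a_g : ∀ i j, inner ℝ (a i) (g j) = if i = j then 2 * Real.pi else 0

namespace Lattice

variable (L : Lattice)

/-- The lattice `Γ`. -/
def Γ : Submodule ℤ Plane := Submodule.span ℤ (Set.range L.a)

/-- The reciprocal lattice `Γ*`. -/
def Γstar : Submodule ℤ Plane := Submodule.span ℤ (Set.range L.g)

/-- The unit cell `Ω` of `Γ`. -/
def Ω : Set Plane := ZSpan.fundamentalDomain L.a

/-- The area `|Ω|`. -/
def area : ℝ := volume.real L.Ω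

/-- The points of the grid `𝒦`. The residue `k = (i, j)`, with representatives
`0 ≤ i < n₁` and `0 ≤ j < n₂`, stands for the momentum `(i / n₁) g₁ + (j / n₂) g₂`. -/
def gridPoint {n₁ n₂ : ℕ} (k : ZMod n₁ × ZMod n₂) : Plane :=
  ((k.1.val : ℝ) / n₁) • L.g 0 + ((k.2.val : ℝ) / n₂) • L.g 1

/-- The points of `𝒦 + Γ*`, labelled by pairs of integers. -/
def momentum (n₁ n₂ : ℕ) (q : ℤ × ℤ) : Plane :=
  ((q.1 : ℝ) / n₁) • L.g 0 + ((q.2 : ℝ) / n₂) • L.g 1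

/-- Reduction of `momentum n₁ n₂ q` modulo `Γ*` to (the label of) a point of the grid. -/
def reduce (n₁ n₂ : ℕ) (q : ℤ × ℤ) : ZMod n₁ × ZMod n₂ := ((q.1 : ZMod n₁), (q.2 : ZMod n₂))

end Lattice

/-- A single particle Hamiltonian, periodic with respect to the lattice: a linear operator, defined
on some space of functions from the plane to `ℂ^κ` (`κ` is the set of internal indices, such as
sublattice and layer), that commutes with the lattice translations and is symmetric on Bloch waves
of equal quasi-momentum. -/
structure PeriodicHamiltonian (L : Lattice) (κ : Type*) [Fintype κ] where
  op : (Plane → EuclideanSpace ℂ κ) →ₗ.[ℂ] (Plane → EuclideanSpace ℂ κ)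
  commutes : ∀ R ∈ L.Γ, ∀ φ : op.domain,
    ∃ h : (fun r => φ.1 (r + R)) ∈ op.domain, op ⟨_, h⟩ = fun r => op φ (r + R)
  symmetric : ∀ (k : Plane) (φ χ : op.domain),
    (∀ R ∈ L.Γ, ∀ r, φ.1 (r + R) = Complex.exp (Complex.I * (inner ℝ k R : ℝ)) • φ.1 r) →
    (∀ R ∈ L.Γ, ∀ r, χ.1 (r + R) = Complex.exp (Complex.I * (inner ℝ k R : ℝ)) • χ.1 r) →
    ∫ r in L.Ω, inner ℂ (op φ r) (χ.1 r) = ∫ r in L.Ω, inner ℂ (φ.1 r) (op χ r)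

/-- A periodic single particle Hamiltonian with flat bands indexed by `𝒩`, together with
its orthonormal Bloch eigenfunctions `ψ n k` on these bands. -/
structure FlatBands (L : Lattice) (𝒩 κ : Type*) [DecidableEq 𝒩] [Fintype κ] where
  /-- the single particle Hamiltonian -/
  H : PeriodicHamiltonian L κ
  /-- the energies of the bands; flatness: they do not depend on `k` -/
  energy : 𝒩 → ℝ
  /-- the Bloch eigenfunctions, with arguments `n`, `k` and `r` -/
  ψ : 𝒩 → Plane → Plane → EuclideanSpace ℂ κ
  bloch : ∀ n k, ∀ R ∈ L.Γ, ∀ r,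
    ψ n k (r + R) = Complex.exp (Complex.I * (inner ℝ k R : ℝ)) • ψ n k r
  eigen : ∀ n k, ∃ h : ψ n k ∈ H.op.domain, H.op ⟨ψ n k, h⟩ = (energy n : ℂ) • ψ n k
  periodic : ∀ n k, ∀ G ∈ L.Γstar, ψ n (k + G) = ψ n k
  memLp : ∀ n k, MemLp (ψ n k) 2 (volume.restrict L.Ω)
  orthonormal : ∀ k m n,
    ∫ r in L.Ω, inner ℂ (ψ m k r) (ψ n k r) = if m = n then (1 : ℂ) else 0

section Model

variable {L : Lattice} {𝒩 κ : Type*} [Fintype 𝒩] [DecidableEq 𝒩] [Fintype κ]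

namespace FlatBands

variable (B : FlatBands L 𝒩 κ)

/-- The periodic Bloch functions `u_{nk}(r) = e^{-i k·r} ψ_{nk}(r)`. -/
def u (n : 𝒩) (k r : Plane) : EuclideanSpace ℂ κ :=
  Complex.exp (-Complex.I * (inner ℝ k r : ℝ)) • B.ψ n k r

/-- The Fourier coefficients `û_{nk}(G; s) = ∫_Ω e^{-i G·r} u_{nk}(r; s) dr`. -/
def uhat (n : 𝒩) (k G : Plane) (s : κ) : ℂ :=
  ∫ r in L.Ω, Complex.exp (-Complex.I * (inner ℝ G r : ℝ)) * B.u n k r s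

/-- The form factors
`[Λ_k(q)]_{mn} = |Ω|⁻¹ ∑_{G ∈ Γ*} ∑_s conj(û_{mk}(G; s)) û_{n(k+q)}(G; s)`. -/
def formFactor (k q : Plane) : Matrix 𝒩 𝒩 ℂ :=
  Matrix.of fun m n =>
    ((L.area : ℂ))⁻¹ * ∑' G : L.Γstar, ∑ s, conj (B.uhat m k G s) * B.uhat n (k + q) G s

variable (n₁ n₂ : ℕ) [NeZero n₁] [NeZero n₂]

open Classical in
/-- The operators
`ρ(q) = ∑_{k ∈ 𝒦} ∑_{m,n} [Λ_k(q)]_{mn} (f†_{mk} f_{n(k+q)} - ½ δ_{mn} δ_{q ∈ Γ*})`, for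
`q ∈ 𝒦 + Γ*`; `f_{n(k+q)}` is the operator at the representative of `k + q` in `𝒦`. -/
def rho (q : ℤ × ℤ) : FockOp (𝒩 × (ZMod n₁ × ZMod n₂)) :=
  ∑ k : ZMod n₁ × ZMod n₂, ∑ m : 𝒩, ∑ n : 𝒩,
    B.formFactor (L.gridPoint k) (L.momentum n₁ n₂ q) m n •
      (create (m, k) * annihilate (n, k + Lattice.reduce n₁ n₂ q)
        - (if m = n ∧ L.momentum n₁ n₂ q ∈ L.Γstar then (1 / 2 : ℂ) else 0) • 1)

/-- The term `V̂(q) ρ(q) ρ(-q)` of the FBI Hamiltonian. -/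
def term (Vhat : Plane → ℝ) (q : ℤ × ℤ) : FockOp (𝒩 × (ZMod n₁ × ZMod n₂)) :=
  (Vhat (L.momentum n₁ n₂ q) : ℂ) • (B.rho n₁ n₂ q * B.rho n₁ n₂ (-q))

/-- The flat band interacting Hamiltonian
`(N_k |Ω|)⁻¹ ∑_{q ∈ 𝒦 + Γ*} V̂(q) ρ(q) ρ(-q)`, where `N_k = n₁ n₂`. -/
def hamiltonian (Vhat : Plane → ℝ) : FockOp (𝒩 × (ZMod n₁ × ZMod n₂)) :=
  ((n₁ * n₂ * L.area : ℝ) : ℂ)⁻¹ • ∑' q : ℤ × ℤ, B.term n₁ n₂ Vhat q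

/-- The FBI Hamiltonian is frustration-free: it has a ground state in which each of its (positive
semidefinite) terms has the energy zero. -/
def FrustrationFree (Vhat : Plane → ℝ) : Prop :=
  ∃ Φ, IsGroundState (B.hamiltonian n₁ n₂ Vhat) Φ ∧
    ∀ q, inner ℂ Φ (B.term n₁ n₂ Vhat q Φ) = 0

/-- A Hartree-Fock ground state: a Slater determinant at half filling (half of
the `(#𝒩) n₁ n₂` modes are filled; `#𝒩 = 2 M`) that is a ground state of the FBI Hamiltonian. -/
def IsHartreeFockGroundState (M : ℕ) (Vhat : Plane → ℝ)
    (Ψ : Fock (𝒩 × (ZMod n₁ × ZMod n₂))) : Prop :=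
  IsSlaterDeterminant (M * (n₁ * n₂)) Ψ ∧ IsGroundState (B.hamiltonian n₁ n₂ Vhat) Ψ

end FlatBands

/-- The one-body reduced density matrix `[P(k, k')]_{nm} = ⟨Ψ, f†_{mk'} f_{nk} Ψ⟩`. -/
def oneRDM {n₁ n₂ : ℕ} [NeZero n₁] [NeZero n₂] (Ψ : Fock (𝒩 × (ZMod n₁ × ZMod n₂)))
    (k k' : ZMod n₁ × ZMod n₂) : Matrix 𝒩 𝒩 ℂ :=
  Matrix.of fun n m => inner ℂ Ψ (create (m, k') (annihilate (n, k) Ψ))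

end Model

end FBI

end

/-! Since `ρ(q)† = ρ(-q)`, the energy of a state is a sum of terms `V̂(q) ‖ρ(-q)Φ‖²` with positive
weights. Frustration-freeness makes the minimal energy zero, so every `ρ(q)` annihilates every
ground state (`rho_apply_eq_zero`). For `q = G` in the reciprocal lattice there is no momentum
transfer: up to a constant, `ρ(G)` is the second quantization of the block diagonal matrix with
blocks `Λ_k(G)`. The ground state is thus an eigenvector of this one-body operator and of its
adjoint, so the matrix commutes with the 1-RDM (`mul_densityMatrix_comm`). The `(k, k')` block of
this relation is the Sylvester equation `Λ_k(G) P(k,k') = P(k,k') Λ_k'(G)`, whose only solution is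
zero when the spectra are disjoint (`eq_zero_of_intertwines`). -/

noncomputable section

namespace FBI

/-! ## Canonical anticommutation relations -/

section Fock

variable {ι : Type*} [Fintype ι] [DecidableEq ι]

/-- The occupation number basis. -/
abbrev occ (S : Finset ι) : Fock ι := EuclideanSpace.single S (1 : ℂ)

theorem inner_occ (S T : Finset ι) : inner ℂ (occ S) (occ T) = if S = T then (1 : ℂ) else 0 := by
  simp [occ, EuclideanSpace.inner_single_left]

theorem fockOp_ext {A B : FockOp ι} (h : ∀ S, A (occ S) = B (occ S)) : A = B := by
  apply ContinuousLinearMap.coe_injective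
  refine (EuclideanSpace.basisFun (Finset ι) ℂ).toBasis.ext fun S => ?_
  simpa using h S

theorem create_occ (i : ι) (S : Finset ι) :
    create i (occ S) = if i ∈ S then 0 else jwSign i S • occ (insert i S) := by
  ext T
  have : create i (occ S) T = if i ∉ S ∧ T = insert i S then jwSign i S else 0 := by
    simp [create, Matrix.ofLp_toEuclideanCLM]
  rw [this]
  by_cases hi : i ∈ S <;> by_cases hT : T = insert i S <;> simp [hi, hT]

theorem jwSign_mul_self (i : ι) (S : Finset ι) : jwSign i S * jwSign i S = 1 := by
  rw [jwSign, ← mul_pow]; simp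

theorem conj_jwSign (i : ι) (S : Finset ι) : conj (jwSign i S) = jwSign i S := by
  simp [jwSign]

/-- The source of the anticommutation signs: of two distinct modes exactly one precedes the other,
so exchanging two operators flips exactly one of the two signs. -/
theorem jwSign_insert {i j : ι} {S : Finset ι} (hj : j ∉ S) :
    jwSign i (insert j S) =
      if Fintype.equivFin ι j < Fintype.equivFin ι i then -jwSign i S else jwSign i S := by
  unfold jwSign
  rw [Finset.filter_insert]
  split_ifs
  · rw [Finset.card_insert_of_notMem (by simp [hj])]; ring
  · rfl

theorem jwSign_erase_self (i : ι) (S : Finset ι) : jwSign i (S.erase i) = jwSign i S := by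
  by_cases h : i ∈ S
  · conv_rhs => rw [← Finset.insert_erase h, jwSign_insert (Finset.notMem_erase i S)]
    simp
  · rw [Finset.erase_eq_of_notMem h]

theorem annihilate_occ (i : ι) (S : Finset ι) :
    annihilate i (occ S) = if i ∈ S then jwSign i S • occ (S.erase i) else 0 := by
  refine InnerProductSpace.ext_inner_left_basis (𝕜 := ℂ)
    (EuclideanSpace.basisFun (Finset ι) ℂ).toBasis fun T => ?_
  have hb : (EuclideanSpace.basisFun (Finset ι) ℂ).toBasis T = occ T := by simp
  rw [hb, annihilate, ContinuousLinearMap.adjoint_inner_right, create_occ]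
  by_cases hT : i ∈ T
  · have : T ≠ S.erase i := by rintro rfl; simp at hT
    by_cases hS : i ∈ S <;> simp [hT, hS, inner_smul_right, inner_occ, this]
  · by_cases hS : i ∈ S
    · by_cases h : T = S.erase i
      · subst h
        simp [hS, inner_smul_left, inner_smul_right, conj_jwSign, jwSign_erase_self,
          Finset.insert_erase hS]
      · have h' : insert i T ≠ S := by
          rintro rfl; exact h (Finset.erase_insert hT).symm
        simp [hT, hS, inner_smul_left, inner_smul_right, inner_occ, h, h']
    · have h' : insert i T ≠ S := by rintro rfl; simp at hS
      simp [hT, hS, inner_smul_left, inner_occ, h']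

theorem create_mul_create (i j : ι) : create i * create j = -(create j * create i) := by
  refine fockOp_ext fun S => ?_
  simp only [mul_apply_eq_comp, _root_.neg_apply, create_occ]
  rcases eq_or_ne i j with rfl | hij
  · by_cases hi : i ∈ S <;> simp [hi, create_occ]
  · by_cases hi : i ∈ S <;> by_cases hj : j ∈ S <;>
      simp [hi, hj, create_occ, hij, hij.symm, jwSign_insert]
    rw [Finset.insert_comm j i, smul_smul, smul_smul, ← neg_smul]
    have hne : Fintype.equivFin ι i ≠ Fintype.equivFin ι j := by simpa using hij
    rcases hne.lt_or_gt with h | h <;> simp [h, h.not_gt, mul_comm]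

theorem annihilate_mul_annihilate (i j : ι) :
    annihilate i * annihilate j = -(annihilate j * annihilate i) := by
  have := congrArg ContinuousLinearMap.adjoint (create_mul_create j i)
  simpa [ContinuousLinearMap.mul_def, ContinuousLinearMap.adjoint_comp, annihilate] using this

theorem annihilate_mul_create (i j : ι) :
    annihilate i * create j = (if i = j then 1 else 0) - create j * annihilate i := by
  refine fockOp_ext fun S => ?_
  rcases eq_or_ne i j with rfl | hij
  · by_cases hi : i ∈ S <;>
      simp [hi, create_occ, annihilate_occ, smul_smul, jwSign_mul_self, jwSign_insert,
        jwSign_erase_self, Finset.insert_erase]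
  · by_cases hi : i ∈ S <;> by_cases hj : j ∈ S <;>
      simp [hi, hj, create_occ, annihilate_occ, hij, hij.symm, jwSign_insert]
    -- The remaining case is `i ∈ S`, `j ∉ S`; expressing everything through `T = S \ {i}` makes the
    -- signs comparable.
    obtain ⟨T, hT, rfl⟩ : ∃ T, i ∉ T ∧ S = insert i T :=
      ⟨S.erase i, by simp, (Finset.insert_erase hi).symm⟩
    have hjT : j ∉ T := fun h => hj (by simp [h])
    rw [Finset.insert_comm j i, Finset.erase_insert hT,
      Finset.erase_insert (by simp [hij, hT]), jwSign_insert hT, jwSign_insert hT, smul_smul,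
      smul_smul, ← neg_smul]
    have hne : Fintype.equivFin ι i ≠ Fintype.equivFin ι j := by simpa using hij
    rcases hne.lt_or_gt with h | h <;> simp [h, h.not_gt, mul_comm]

/-- Normal ordering both products leaves the same quartic term, because its two sign changes cancel;
only the contractions survive. -/
theorem commutator_create_mul_annihilate (j i a b : ι) :
    create j * annihilate i * (create a * annihilate b)
        - create a * annihilate b * (create j * annihilate i) =
      (if i = a then create j * annihilate b else 0)
        - (if b = j then create a * annihilate i else 0) := by
  have h₁ : create j * annihilate i * (create a * annihilate b) =
      (if i = a then create j * annihilate b else 0)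
        - create j * create a * (annihilate i * annihilate b) := by
    rw [mul_assoc, ← mul_assoc (annihilate i), annihilate_mul_create]
    split_ifs <;> simp only [sub_mul, mul_sub, one_mul, zero_mul, mul_zero, mul_assoc]
  have h₂ : create a * annihilate b * (create j * annihilate i) =
      (if b = j then create a * annihilate i else 0)
        - create a * create j * (annihilate b * annihilate i) := by
    rw [mul_assoc, ← mul_assoc (annihilate b), annihilate_mul_create]
    split_ifs <;> simp only [sub_mul, mul_sub, one_mul, zero_mul, mul_zero, mul_assoc]
  rw [h₁, h₂, create_mul_create a j, annihilate_mul_annihilate b i]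
  rw [neg_mul_neg (create j * create a)]
  abel

theorem adjoint_create_mul_annihilate (i j : ι) :
    ContinuousLinearMap.adjoint (create i * annihilate j) = create j * annihilate i := by
  simp [ContinuousLinearMap.mul_def, ContinuousLinearMap.adjoint_comp, annihilate]

/-! ## One-body operators -/

/-- The second quantization `∑ A_{ij} f†_i f_j` of a matrix. -/
def oneBody (A : Matrix ι ι ℂ) : FockOp ι := ∑ i, ∑ j, A i j • (create i * annihilate j)

/-- The one-body density matrix `⟨Ψ, f†_j f_i Ψ⟩`. -/
def densityMatrix (Ψ : Fock ι) : Matrix ι ι ℂ :=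
  Matrix.of fun i j => inner ℂ Ψ ((create j * annihilate i) Ψ)

/-- The expectation of the right side in `Ψ` is the `(i, j)` entry of `A P - P A`, with `P` the
density matrix. -/
theorem commutator_oneBody (A : Matrix ι ι ℂ) (i j : ι) :
    create j * annihilate i * oneBody A - oneBody A * (create j * annihilate i) =
      ∑ b, A i b • (create j * annihilate b) - ∑ a, A a j • (create a * annihilate i) := by
  have : create j * annihilate i * oneBody A - oneBody A * (create j * annihilate i) =
      ∑ a, ∑ b, A a b • (create j * annihilate i * (create a * annihilate b)
        - create a * annihilate b * (create j * annihilate i)) := by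
    simp only [oneBody, Finset.mul_sum, Finset.sum_mul, ← Finset.sum_sub_distrib, smul_sub,
      mul_smul_comm, smul_mul_assoc]
  rw [this]
  simp only [commutator_create_mul_annihilate, smul_sub, Finset.sum_sub_distrib, smul_ite,
    smul_zero]
  congr 1
  · rw [Finset.sum_comm]; simp
  · simp

/-- If `Ψ` is an eigenvector of the second quantization of `A` and of its adjoint, then `A`
commutes with the one-body density matrix of `Ψ`. -/
theorem mul_densityMatrix_comm (A : Matrix ι ι ℂ) (Ψ : Fock ι) (c : ℂ)
    (h : oneBody A Ψ = c • Ψ)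
    (h' : ContinuousLinearMap.adjoint (oneBody A) Ψ = conj c • Ψ) :
    A * densityMatrix Ψ = densityMatrix Ψ * A := by
  ext i j
  -- `oneBody A` acts as `c` on the right `Ψ` and, through its adjoint, also as `c` on the left `Ψ`,
  -- so the two products have the same expectation.
  have hl : inner ℂ Ψ ((create j * annihilate i * oneBody A
      - oneBody A * (create j * annihilate i)) Ψ) = 0 := by
    rw [_root_.sub_apply, mul_apply_eq_comp,
      mul_apply_eq_comp (oneBody A), inner_sub_right,
      ← ContinuousLinearMap.adjoint_inner_left (oneBody A), h, h', map_smul, inner_smul_left,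
      inner_smul_right]
    simp
  rw [commutator_oneBody] at hl
  simp only [_root_.sub_apply, inner_sub_right, _root_.sum_apply,
    inner_sum, _root_.smul_apply, inner_smul_right] at hl
  simp only [Matrix.mul_apply, densityMatrix, Matrix.of_apply]
  exact (sub_eq_zero.1 hl).trans <| Finset.sum_congr rfl fun _ _ => mul_comm _ _

end Fock

/-! ## Sylvester's equation -/

/-- Matrices without a common eigenvalue have no nonzero intertwiner. -/
theorem eq_zero_of_intertwines {n : Type*} [Fintype n] [DecidableEq n] {A B X : Matrix n n ℂ}
    (hAB : Disjoint (spectrum ℂ A) (spectrum ℂ B)) (h : A * X = X * B) : X = 0 := by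
  -- The spectral mapping theorem used below needs a nonempty spectrum.
  cases isEmpty_or_nonempty n
  · exact Subsingleton.elim _ _
  have hp : ∀ p : Polynomial ℂ, Polynomial.aeval A p * X = X * Polynomial.aeval B p := by
    intro p
    induction p using Polynomial.induction_on' with
    | add p q hp hq => simp [add_mul, mul_add, hp, hq]
    | monomial k a =>
      have hk : A ^ k * X = X * B ^ k := by
        induction k with
        | zero => simp
        | succ k ih => rw [pow_succ, mul_assoc, h, ← mul_assoc, ih, mul_assoc, ← pow_succ]
      simp [Polynomial.aeval_monomial, ← Algebra.smul_def, hk]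
  -- Cayley-Hamilton for `B`, carried across `X`.
  have h0 : Polynomial.aeval A B.charpoly * X = 0 := by
    rw [hp, Matrix.aeval_self_charpoly, mul_zero]
  -- The eigenvalues of `p_B(A)` are the values of `p_B` on the spectrum of `A`, which contains no
  -- root of `p_B`.
  have hu : IsUnit (Polynomial.aeval A B.charpoly) := by
    rw [← spectrum.zero_notMem_iff ℂ,
      spectrum.map_polynomial_aeval_of_nonempty A _ (spectrum.nonempty_of_isAlgClosed_of_finiteDimensional ℂ A)]
    rintro ⟨z, hz, hz'⟩
    exact Set.disjoint_left.1 hAB hz (Matrix.mem_spectrum_iff_isRoot_charpoly.2 hz')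
  exact hu.mul_right_eq_zero.1 h0

/-! ## Form factors and density operators -/

namespace Lattice

variable (L : Lattice)

theorem area_pos : 0 < L.area :=
  ENNReal.toReal_pos (ZSpan.measure_fundamentalDomain_ne_zero L.a)
    (ZSpan.fundamentalDomain_isBounded L.a).measure_lt_top.ne

theorem momentum_neg (n₁ n₂ : ℕ) (q : ℤ × ℤ) :
    L.momentum n₁ n₂ (-q) = -L.momentum n₁ n₂ q := by
  simp [momentum, neg_div, add_comm]

theorem int_combination_mem (a b : ℤ) : (a : ℝ) • L.g 0 + (b : ℝ) • L.g 1 ∈ L.Γstar := by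
  rw [Int.cast_smul_eq_zsmul, Int.cast_smul_eq_zsmul]
  exact add_mem (L.Γstar.smul_mem _ (Submodule.subset_span ⟨0, rfl⟩))
    (L.Γstar.smul_mem _ (Submodule.subset_span ⟨1, rfl⟩))

variable (n₁ n₂ : ℕ) [NeZero n₁] [NeZero n₂]

/-- Integer coordinates of `G`, multiplied by `n₁` and `n₂`, give a label that reduces to zero on
the grid. -/
theorem exists_momentum_eq {G : Plane} (hG : G ∈ L.Γstar) :
    ∃ q, L.momentum n₁ n₂ q = G ∧ reduce n₁ n₂ q = 0 := by
  obtain ⟨c, rfl⟩ := (Submodule.mem_span_range_iff_exists_fun ℤ).1 hG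
  refine ⟨(c 0 * n₁, c 1 * n₂), ?_, by simp [reduce]⟩
  have h₁ : (n₁ : ℝ) ≠ 0 := NeZero.ne _
  have h₂ : (n₂ : ℝ) ≠ 0 := NeZero.ne _
  simp [momentum, h₁, h₂, Fin.sum_univ_two, Int.cast_smul_eq_zsmul]

theorem exists_val_add_intCast (n : ℕ) [NeZero n] (k : ZMod n) (a : ℤ) :
    ∃ c : ℤ, ((k + (a : ZMod n)).val : ℝ) / n = (k.val : ℝ) / n + a / n + c := by
  have h : (n : ℤ) ∣ ((k + (a : ZMod n)).val : ℤ) - (k.val + a) := by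
    rw [← ZMod.intCast_zmod_eq_zero_iff_dvd]
    simp
  obtain ⟨c, hc⟩ := h
  refine ⟨c, ?_⟩
  have hn : (n : ℝ) ≠ 0 := NeZero.ne _
  have hc' : ((k + (a : ZMod n)).val : ℝ) - (k.val + a) = n * c := by exact_mod_cast hc
  field_simp
  linarith

/-- The grid point of `k + q` agrees with the sum of the momenta modulo `Γ*`. -/
theorem exists_gridPoint_add_reduce (k : ZMod n₁ × ZMod n₂) (q : ℤ × ℤ) :
    ∃ G ∈ L.Γstar,
      L.gridPoint (k + reduce n₁ n₂ q) = L.gridPoint k + L.momentum n₁ n₂ q + G := by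
  obtain ⟨c, hc⟩ := exists_val_add_intCast n₁ k.1 q.1
  obtain ⟨d, hd⟩ := exists_val_add_intCast n₂ k.2 q.2
  refine ⟨_, L.int_combination_mem c d, ?_⟩
  simp only [gridPoint, reduce, momentum, Prod.fst_add, Prod.snd_add, hc, hd]
  module

end Lattice

section Model

variable {L : Lattice} {𝒩 κ : Type*} [Fintype 𝒩] [DecidableEq 𝒩] [Fintype κ]

namespace FlatBands

variable (B : FlatBands L 𝒩 κ)

/-- Periodicity of `ψ` in `k` gives `u_{n(k+G)} = e^{-i G·r} u_{nk}`, and this phase shifts the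
Fourier index. -/
theorem uhat_add (n : 𝒩) (k : Plane) {G : Plane} (hG : G ∈ L.Γstar) (G' : Plane) (s : κ) :
    B.uhat n (k + G) G' s = B.uhat n k (G' + G) s := by
  unfold uhat u
  congr 1
  ext r
  rw [B.periodic n k G hG]
  simp only [PiLp.smul_apply, smul_eq_mul, ← mul_assoc, ← Complex.exp_add, inner_add_left]
  congr 2
  push_cast
  ring

/-- Both Fourier indices shift by the same `G`, which the sum over `Γ*` absorbs. -/
theorem formFactor_add (k q : Plane) {G : Plane} (hG : G ∈ L.Γstar) :
    B.formFactor (k + G) q = B.formFactor k q := by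
  ext m n
  simp only [formFactor, Matrix.of_apply]
  congr 1
  rw [← (Equiv.addRight (⟨G, hG⟩ : L.Γstar)).tsum_eq
    (fun G' : L.Γstar => ∑ s, conj (B.uhat m k G' s) * B.uhat n (k + q) G' s)]
  refine tsum_congr fun G' => Finset.sum_congr rfl fun s _ => ?_
  rw [add_right_comm k G q, B.uhat_add _ _ hG, B.uhat_add _ _ hG]
  rfl

theorem conj_formFactor (k q : Plane) (m n : 𝒩) :
    conj (B.formFactor k q m n) = B.formFactor (k + q) (-q) n m := by
  simp only [formFactor, Matrix.of_apply, map_mul, map_inv₀, Complex.conj_ofReal,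
    Complex.conj_tsum, map_sum, Complex.conj_conj, add_neg_cancel_right]
  congr 1
  exact tsum_congr fun G' => Finset.sum_congr rfl fun s _ => mul_comm _ _

variable (n₁ n₂ : ℕ) [NeZero n₁] [NeZero n₂]

theorem conj_formFactor_gridPoint (k : ZMod n₁ × ZMod n₂) (q : ℤ × ℤ) (m n : 𝒩) :
    conj (B.formFactor (L.gridPoint k) (L.momentum n₁ n₂ q) m n) =
      B.formFactor (L.gridPoint (k + Lattice.reduce n₁ n₂ q)) (L.momentum n₁ n₂ (-q)) n m := by
  obtain ⟨G, hG, h⟩ := L.exists_gridPoint_add_reduce n₁ n₂ k q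
  rw [h, B.formFactor_add _ _ hG, B.conj_formFactor, L.momentum_neg]

/-- The adjoint of `f†_{mk} f_{n(k+q)}` starts from momentum `k + q` and transfers `-q`; the form
factors conjugate accordingly, and the subtracted constant is real and diagonal. -/
theorem adjoint_rho (q : ℤ × ℤ) :
    ContinuousLinearMap.adjoint (B.rho n₁ n₂ q) = B.rho n₁ n₂ (-q) := by
  have hred : ∀ k : ZMod n₁ × ZMod n₂,
      k + Lattice.reduce n₁ n₂ q + Lattice.reduce n₁ n₂ (-q) = k := by
    intro k; ext <;> simp [Lattice.reduce]
  unfold rho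
  -- Substitute `k ↦ k + q` on the grid to match the two sums term by term.
  conv_rhs => rw [← Equiv.sum_comp (Equiv.addRight (Lattice.reduce n₁ n₂ q))]
  simp only [map_sum]
  refine Finset.sum_congr rfl fun k _ => ?_
  rw [Finset.sum_comm]
  refine Finset.sum_congr rfl fun n _ => Finset.sum_congr rfl fun m _ => ?_
  simp only [Equiv.coe_addRight, hred]
  simp only [LinearIsometryEquiv.map_smulₛₗ, map_sub, adjoint_create_mul_annihilate]
  congr 2
  · exact B.conj_formFactor_gridPoint n₁ n₂ k q m n
  · rw [← ContinuousLinearMap.star_eq_adjoint, star_one]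
    congr 1
    rw [L.momentum_neg, neg_mem_iff]
    by_cases h : m = n
    · subst h
      split_ifs <;> simp [Complex.ext_iff]
    · simp [h, Ne.symm h]

/-! ### Positivity of the energy and zero-energy ground states -/

theorem inner_term (Vhat : Plane → ℝ) (q : ℤ × ℤ) (Φ : Fock (𝒩 × (ZMod n₁ × ZMod n₂))) :
    inner ℂ Φ (B.term n₁ n₂ Vhat q Φ) =
      ((Vhat (L.momentum n₁ n₂ q) * ‖B.rho n₁ n₂ (-q) Φ‖ ^ 2 : ℝ) : ℂ) := by
  rw [term, _root_.smul_apply, mul_apply_eq_comp, inner_smul_right,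
    ← ContinuousLinearMap.adjoint_inner_left, B.adjoint_rho, inner_self_eq_norm_sq_to_K]
  push_cast
  rfl

/-- Taking the expectation in `Φ` is a continuous linear functional of the operator, so it passes
through the series. -/
theorem hasSum_inner_hamiltonian {Vhat : Plane → ℝ} (hconv : Summable (B.term n₁ n₂ Vhat))
    (Φ : Fock (𝒩 × (ZMod n₁ × ZMod n₂))) :
    HasSum (fun q => (n₁ * n₂ * L.area : ℝ)⁻¹ *
        (Vhat (L.momentum n₁ n₂ q) * ‖B.rho n₁ n₂ (-q) Φ‖ ^ 2))
      (inner ℂ Φ (B.hamiltonian n₁ n₂ Vhat Φ)).re := by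
  have h₁ := ((ContinuousLinearMap.apply ℂ (Fock (𝒩 × (ZMod n₁ × ZMod n₂))) Φ).hasSum
    hconv.hasSum)
  have h₂ := ((innerSL ℂ Φ).hasSum h₁).mul_left ((n₁ * n₂ * L.area : ℝ) : ℂ)⁻¹
  have h₃ := Complex.hasSum_re h₂
  convert h₃ using 1
  · ext q
    have := B.inner_term n₁ n₂ Vhat q Φ
    simp only [ContinuousLinearMap.apply_apply, innerSL_apply_apply]
    rw [this, ← Complex.ofReal_inv, ← Complex.ofReal_mul, Complex.ofReal_re]
  · simp [hamiltonian]

/-- The ground states of a frustration-free FBI Hamiltonian are annihilated by every `ρ(q)`. -/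
theorem rho_apply_eq_zero {Vhat : Plane → ℝ} (hVpos : ∀ q, 0 < Vhat q)
    (hconv : Summable (B.term n₁ n₂ Vhat)) (hff : B.FrustrationFree n₁ n₂ Vhat)
    {Ψ : Fock (𝒩 × (ZMod n₁ × ZMod n₂))} (hΨ : IsGroundState (B.hamiltonian n₁ n₂ Vhat) Ψ)
    (q : ℤ × ℤ) : B.rho n₁ n₂ q Ψ = 0 := by
  obtain ⟨Φ, hΦ, hΦ0⟩ := hff
  have hc : 0 < (n₁ * n₂ * L.area : ℝ)⁻¹ := by
    have h₁ : (0 : ℝ) < n₁ := Nat.cast_pos.2 (NeZero.pos n₁)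
    have h₂ : (0 : ℝ) < n₂ := Nat.cast_pos.2 (NeZero.pos n₂)
    have := L.area_pos
    positivity
  have hE : (inner ℂ Φ (B.hamiltonian n₁ n₂ Vhat Φ)).re = 0 := by
    refine (B.hasSum_inner_hamiltonian n₁ n₂ hconv Φ).unique ?_
    convert hasSum_zero with q
    have := hΦ0 q
    rw [B.inner_term] at this
    rw [Complex.ofReal_eq_zero.1 this, mul_zero]
  have hs := B.hasSum_inner_hamiltonian n₁ n₂ hconv Ψ
  have hle := hΨ.2 Φ hΦ.1
  rw [hE] at hle
  have hnn : ∀ q, 0 ≤ (n₁ * n₂ * L.area : ℝ)⁻¹ *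
      (Vhat (L.momentum n₁ n₂ q) * ‖B.rho n₁ n₂ (-q) Ψ‖ ^ 2) := fun q => by
    have := hVpos (L.momentum n₁ n₂ q)
    positivity
  -- `Ψ` has energy at most that of `Φ`, namely zero; a nonnegative series with sum zero vanishes
  -- termwise.
  rw [le_antisymm hle (hs.nonneg hnn), hasSum_zero_iff_of_nonneg hnn] at hs
  -- The term at `q` controls `ρ(-q)Ψ`, so the index is negated.
  have := congrFun hs (-q)
  rw [Pi.zero_apply, mul_eq_zero_iff_left hc.ne', mul_eq_zero_iff_left (hVpos _).ne'] at this
  simpa using this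

/-- For `q` in the reciprocal lattice, `ρ(q)` is a one-body operator up to a constant. -/
theorem exists_oneBody_sub_rho {q : ℤ × ℤ} (hq : Lattice.reduce n₁ n₂ q = 0) :
    ∃ c : ℂ, oneBody (Matrix.blockDiagonal fun k : ZMod n₁ × ZMod n₂ =>
      B.formFactor (L.gridPoint k) (L.momentum n₁ n₂ q)) = B.rho n₁ n₂ q + c • 1 := by
  classical
  refine ⟨∑ k : ZMod n₁ × ZMod n₂, ∑ m : 𝒩, ∑ n : 𝒩,
    B.formFactor (L.gridPoint k) (L.momentum n₁ n₂ q) m n *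
      (if m = n ∧ L.momentum n₁ n₂ q ∈ L.Γstar then (1 / 2 : ℂ) else 0), ?_⟩
  simp only [rho, hq, add_zero, oneBody, smul_sub, Finset.sum_sub_distrib]
  simp only [Finset.sum_smul (M := FockOp (𝒩 × (ZMod n₁ × ZMod n₂))), mul_smul, sub_add_cancel]
  rw [Fintype.sum_prod_type, Finset.sum_comm]
  refine Finset.sum_congr rfl fun k _ => Finset.sum_congr rfl fun m _ => ?_
  rw [Fintype.sum_prod_type]
  refine Finset.sum_congr rfl fun n _ => ?_
  simp [Matrix.blockDiagonal_apply, zero_smul ℂ (_ : FockOp (𝒩 × (ZMod n₁ × ZMod n₂)))]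

end FlatBands

end Model

end FBI

end

/-- No translation symmetry breaking. -/
theorem mainTheorem5 {𝒩 κ : Type*} [Fintype 𝒩] [DecidableEq 𝒩] [Fintype κ]
    (L : FBI.Lattice) (B : FBI.FlatBands L 𝒩 κ)
    (n₁ n₂ : ℕ) [NeZero n₁] [NeZero n₂]
    (M : ℕ) (hM : Fintype.card 𝒩 = 2 * M)
    (Vhat : FBI.Plane → ℝ) (hVpos : ∀ q, 0 < Vhat q)
    (hVradial : ∀ q q', ‖q‖ = ‖q'‖ → Vhat q = Vhat q')
    (hconv : Summable (B.term n₁ n₂ Vhat))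
    (hff : B.FrustrationFree n₁ n₂ Vhat)
    (Ψ : FBI.Fock (𝒩 × (ZMod n₁ × ZMod n₂)))
    (hΨ : B.IsHartreeFockGroundState n₁ n₂ M Vhat Ψ) :
    ∀ k k' : ZMod n₁ × ZMod n₂,
      (∃ G ∈ L.Γstar, Disjoint (spectrum ℂ (B.formFactor (L.gridPoint k) G))
        (spectrum ℂ (B.formFactor (L.gridPoint k') G))) →
      FBI.oneRDM Ψ k k' = 0 := by
  classical
  rintro k k' ⟨G, hG, hdisj⟩
  obtain ⟨q, rfl, hq⟩ := L.exists_momentum_eq n₁ n₂ hG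
  have h₀ := fun q => B.rho_apply_eq_zero n₁ n₂ hVpos hconv hff hΨ.2 q
  obtain ⟨c, hc⟩ := B.exists_oneBody_sub_rho n₁ n₂ hq
  have hcomm := FBI.mul_densityMatrix_comm
    (Matrix.blockDiagonal fun k => B.formFactor (L.gridPoint k) (L.momentum n₁ n₂ q)) Ψ c
    -- The eigenvalue `c` is the constant shift. The adjoint has eigenvalue `conj c`, because `ρ(q)†
    -- = ρ(-q)` annihilates `Ψ` as well.
    (by simp [hc, h₀]) (by
    rw [hc, map_add, B.adjoint_rho, LinearIsometryEquiv.map_smulₛₗ,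
      ← ContinuousLinearMap.star_eq_adjoint, star_one]
    simp [h₀])
  refine FBI.eq_zero_of_intertwines hdisj ?_
  ext m n
  -- Block diagonality collapses the momentum sums, leaving `Λ_k(G)` on the left and `Λ_k'(G)` on
  -- the right.
  have := congrFun (congrFun hcomm (m, k)) (n, k')
  simpa [Matrix.mul_apply, Fintype.sum_prod_type, Matrix.blockDiagonal_apply, ite_mul, mul_ite,
    FBI.densityMatrix, FBI.oneRDM] using this
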